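/- Caching in Matchings with parameters $n,k$: requests arrive online for edges $(u,v)\in V^{in}\times V^{out}$ of a complete bipartite graph with $|V^{in}|=|V^{out}|=n$. The cache, initially empty, consists of $k$ pairwise disjoint matchings (i.e. it is a properly $k$-edge-colored set of edges), and every requested edge must be in the cache once its request has been served. An algorithm may add and evict edges at any time; adding an edge to a matching costs $1$ (so recoloring a cached edge costs $1$ as well) and evictions are free. Let $OPT_k(\sigma)$ be the minimum cost of serving the request sequence $\sigma$ offline with $k$ matchings. A randomized online algorithm is $C$-competitive if there is a constant $d$ (which may depend on $n$ and $k$) such that $\mathbb{E}[cost(ALG(\sigma))]\le C\cdot OPT_k(\sigma)+d$ for every request sequence $\sigma$. Consider the following randomized algorithm $ALG$. If the requested edge is cached, do nothing. If it is missing and some matching can accommodate it without a conflict, put it into such a matching (when several can accommodate it, an arbitrary one of them). If it is missing and no matching can accommodate it, pick one of the $k$ matchings uniformly at random, put the edge into it, and evict from that matching the edges that share an endpoint with the new edge. Lemma. For $k=2$, $ALG$ is $\Omega(n)$-competitive: there are absolute constants $c>0$ and $N$ such that for all $n\ge N$, whatever rule (possibly randomized and depending on the past) is used to choose among several accommodating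 matchings, if $ALG$ is $C$-competitive then $C\ge c\,n$. -/

import Mathlib

open scoped NNReal ENNReal

namespace CachingInMatchings

/-- A link of the complete bipartite graph with `n` nodes on each side. -/
abbrev Edge (n : ℕ) := Fin n × Fin n

/-- Two links share an endpoint. -/
def Touch {n : ℕ} (e f : Edge n) : Prop := e.1 = f.1 ∨ e.2 = f.2

/-- A cache made of `k` matchings: `color e = some c` says that `e` is cached in matching `c`,
and `color e = none` says that `e` is not cached. -/
@[ext]
structure Cache (n k : ℕ) where
  color : Edge n → Option (Fin k)
  proper : ∀ (c : Fin k) (e f : Edge n),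
    color e = some c → color f = some c → Touch e f → e = f

namespace Cache

variable {n k : ℕ}

/-- The cache without links. -/
def empty (n k : ℕ) : Cache n k where
  color := fun _ => none
  proper := by
    intro c e f he
    simp at he

/-- The link `e` is cached (in one of the matchings). -/
def Has (M : Cache n k) (e : Edge n) : Prop := M.color e ≠ none

/-- Matching `c` can accommodate `e`: none of its links touches `e`. -/
def Free (M : Cache n k) (e : Edge n) (c : Fin k) : Prop :=
  ∀ f : Edge n, M.color f = some c → ¬ Touch e f

open Classical in
/-- Put `e` into matching `c`, evicting from matching `c` all links that touch `e`. -/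
noncomputable def insert (M : Cache n k) (e : Edge n) (c : Fin k) : Cache n k where
  color := fun f =>
    if f = e then some c
    else if M.color f = some c ∧ Touch e f then none
    else M.color f
  proper := by
    intro c' f g hf hg hfg
    by_cases h1 : f = e
    · subst h1
      by_cases h2 : g = f
      · exact h2.symm
      · simp only [if_true, Option.some.injEq] at hf
        subst hf
        simp only [h2, if_false] at hg
        split_ifs at hg with h3
        exact absurd ⟨hg, hfg⟩ h3
    · by_cases h2 : g = e
      · subst h2
        simp only [if_true, Option.some.injEq] at hg
        subst hg
        simp only [h1, if_false] at hf
        split_ifs at hf with h3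
        exact absurd ⟨hf, hfg.imp Eq.symm Eq.symm⟩ h3
      · simp only [h1, h2, if_false] at hf hg
        split_ifs at hf with h3
        split_ifs at hg with h4
        exact M.proper c' f g hf hg hfg

open Classical in
/-- The cost of changing the cache from `M` to `M'`: one per link added to a matching. Recoloring
a link means adding it to another matching, and costs one; evictions are free. -/
noncomputable def fetchCost (M M' : Cache n k) : ℕ :=
  (Finset.univ.filter fun e : Edge n => M'.color e ≠ none ∧ M'.color e ≠ M.color e).card

end Cache

/-- An execution, newest step first: the requests so far, each together with the cache right after
that request was handled. Executions start from the empty cache. -/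
abbrev Execution (n k : ℕ) := List (Edge n × Cache n k)

namespace Execution

variable {n k : ℕ}

/-- The cache at the end of an execution. -/
def current : Execution n k → Cache n k
  | [] => Cache.empty n k
  | (_, M) :: _ => M

/-- The total cost of an execution. -/
noncomputable def cost : Execution n k → ℕ
  | [] => 0
  | (_, M) :: x => cost x + Cache.fetchCost (current x) M

/-- The execution handles exactly the requests `σ` (oldest first), and every requested link is
cached right after it was requested. -/
def Serves (x : Execution n k) (σ : List (Edge n)) : Prop :=
  x.reverse.map Prod.fst = σ ∧ ∀ p ∈ x, p.2.Has p.1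

end Execution

/-- The optimal offline cost of serving `σ` with `k` matchings. -/
noncomputable def opt (n k : ℕ) (σ : List (Edge n)) : ℕ :=
  sInf {m : ℕ | ∃ x : Execution n k, x.Serves σ ∧ x.cost = m}

/-- A randomized online algorithm: given the execution so far and the next request, the law of the
next cache. -/
abbrev OnlineAlg (n k : ℕ) := Execution n k → Edge n → PMF (Cache n k)

namespace OnlineAlg

variable {n k : ℕ}

/-- The law of the execution obtained by handling the requests `σ` after the execution `x`. -/
noncomputable def runFrom (A : OnlineAlg n k) : Execution n k → List (Edge n) → PMF (Execution n k)
  | x, [] => PMF.pure x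
  | x, e :: σ => (A x e).bind fun M => runFrom A ((e, M) :: x) σ

/-- The expected cost of the algorithm on the request sequence `σ`. -/
noncomputable def expectedCost (A : OnlineAlg n k) (σ : List (Edge n)) : ℝ≥0∞ :=
  ∑' x : Execution n k, A.runFrom [] σ x * (x.cost : ℝ≥0∞)

/-- On every request sequence, the expected cost is at most `C` times the optimal offline cost,
plus `d`. -/
def IsCompetitive (A : OnlineAlg n k) (C d : ℝ≥0) : Prop :=
  ∀ σ : List (Edge n), A.expectedCost σ ≤ (C : ℝ≥0∞) * (opt n k σ : ℝ≥0∞) + (d : ℝ≥0∞)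

/-- The naive randomized algorithm. Nothing is assumed about which matching is used when
several of them can accommodate the requested link: this choice may be random and may depend on
the whole past. -/
structure IsNaive [NeZero k] (A : OnlineAlg n k) : Prop where
  /-- A cached link is a hit: nothing changes. -/
  hit : ∀ (x : Execution n k) (e : Edge n), x.current.Has e → A x e = PMF.pure x.current
  /-- A missing link that some matching can accommodate is put into such a matching. -/
  fits : ∀ (x : Execution n k) (e : Edge n), ¬ x.current.Has e →
    (∃ c, x.current.Free e c) →
    ∀ M ∈ (A x e).support, ∃ c, x.current.Free e c ∧ M = x.current.insert e c
  /-- Otherwise the matching is uniformly random, and the conflicting links are evicted from it. -/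
  conflict : ∀ (x : Execution n k) (e : Edge n), ¬ x.current.Has e →
    (¬ ∃ c, x.current.Free e c) →
    A x e = (PMF.uniformOfFintype (Fin k)).map fun c => x.current.insert e c

end OnlineAlg

end CachingInMatchings

/-!
A path of the bipartite graph has exactly two proper colorings with two colors, so if two cached
pieces of a path are colored inconsistently, the link `e` between them cannot be cached without
evicting something. A request for `e` then evicts one of its two neighbours, each with probability
`1/2`: the missing link performs a simple random walk along the path, every step of which costs
one, until it reaches an end of the path (`potential_le_mean`). From the middle of a path with
`4 * b + 1` links this takes `4 * b ^ 2` steps in expectation, whereas offline the whole path can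
be brought into the cache for `4 * b + 1`.

The request sequence consists of phases. A phase first requests two halves of a path, each with
`2 * b` links, so often that from any cache both are cached with probability at least `3/4`. This
works since every request for a missing link keeps all links requested before it in the same pass
with probability at least `1/2` (`mean_miss_succ_le`), so that a pass succeeds with a probability
bounded below. How the algorithm has colored the two halves depends on its rule for links that
fit, but the second half has an even number of links, so its two end links have different colors.
Hence if the first half is joined to one or to the other end of the second half, a conflict
arises in exactly one of the two cases (`le_potential_add_potential`). The adversary knows the
algorithm and picks the end for which the conflict is more likely. The phase then requests the
joined path over and over until it is cached with probability at least `3/4`. By the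
submartingale property of cost plus potential, the phase costs at least `b ^ 2 / 2` in expectation
(`exists_requests`), and the number of phases is arbitrary.

Expectations are taken in `ℝ≥0∞`, so that no question of convergence arises; the potential and the
probability of a miss are functions of the current cache only, while the algorithm may depend on
the whole past.
-/

namespace CachingInMatchings

/-! ### Expectations and single steps -/

/-- The expectation of `f` under the law `p`. -/
noncomputable def mean {α : Type*} (p : PMF α) (f : α → ℝ≥0∞) : ℝ≥0∞ := ∑' a, p a * f a

section Mean

variable {α β : Type*}

theorem mean_pure (a : α) (f : α → ℝ≥0∞) : mean (PMF.pure a) f = f a := by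
  classical
  unfold mean
  rw [tsum_eq_single a]
  · simp
  · intro b hb
    simp [PMF.pure_apply, hb]

theorem mean_bind (p : PMF α) (q : α → PMF β) (f : β → ℝ≥0∞) :
    mean (p.bind q) f = mean p fun a => mean (q a) f := by
  unfold mean
  simp_rw [PMF.bind_apply, ← ENNReal.tsum_mul_right, ← ENNReal.tsum_mul_left]
  rw [ENNReal.tsum_comm]
  simp_rw [mul_assoc]

theorem mean_map (p : PMF α) (g : α → β) (f : β → ℝ≥0∞) :
    mean (p.map g) f = mean p fun a => f (g a) := by
  rw [← PMF.bind_pure_comp, mean_bind]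
  simp [mean_pure]

theorem mean_mono_of_support {p : PMF α} {f g : α → ℝ≥0∞} (h : ∀ a ∈ p.support, f a ≤ g a) :
    mean p f ≤ mean p g := by
  refine ENNReal.tsum_le_tsum fun a => ?_
  by_cases ha : p a = 0
  · simp [ha]
  · exact mul_le_mul_right (h a ((PMF.mem_support_iff p a).2 ha)) _

theorem mean_mono {p : PMF α} {f g : α → ℝ≥0∞} (h : ∀ a, f a ≤ g a) : mean p f ≤ mean p g :=
  mean_mono_of_support fun a _ => h a

theorem mean_const (p : PMF α) (c : ℝ≥0∞) : mean p (fun _ => c) = c := by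
  unfold mean
  rw [ENNReal.tsum_mul_right, p.tsum_coe, one_mul]

theorem mean_add (p : PMF α) (f g : α → ℝ≥0∞) :
    mean p (fun a => f a + g a) = mean p f + mean p g := by
  unfold mean
  simp_rw [mul_add]
  exact ENNReal.tsum_add

theorem mean_const_mul (p : PMF α) (c : ℝ≥0∞) (f : α → ℝ≥0∞) :
    mean p (fun a => c * f a) = c * mean p f := by
  unfold mean
  rw [← ENNReal.tsum_mul_left]
  simp_rw [mul_left_comm]

/-- The two matchings of the uniform law may be listed in any order. -/
theorem mean_uniform_two {a b : Fin 2} (hab : a ≠ b) (f : Fin 2 → ℝ≥0∞) :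
    mean (PMF.uniformOfFintype (Fin 2)) f = (f a + f b) / 2 := by
  have h : mean (PMF.uniformOfFintype (Fin 2)) f = (f 0 + f 1) / 2 := by
    simp [mean, tsum_fintype, ENNReal.div_eq_inv_mul, mul_add]
  rw [h]
  fin_cases a <;> fin_cases b <;> simp_all [add_comm]

end Mean

section Insertion

variable {n k : ℕ}

namespace Cache

theorem color_insert_self (M : Cache n k) (e : Edge n) (c : Fin k) :
    (M.insert e c).color e = some c := by
  simp [insert]

theorem has_insert_self (M : Cache n k) (e : Edge n) (c : Fin k) : (M.insert e c).Has e := by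
  simp [Has, color_insert_self]

theorem color_insert_of_ne {M : Cache n k} {e f : Edge n} {c : Fin k} (hfe : f ≠ e)
    (h : M.color f = some c → ¬ Touch e f) : (M.insert e c).color f = M.color f := by
  have h' : ¬ (M.color f = some c ∧ Touch e f) := fun h' => h h'.1 h'.2
  simp [insert, hfe, h']

theorem Has.insert {M : Cache n k} {e f : Edge n} {c : Fin k} (hf : M.Has f)
    (h : M.color f = some c → ¬ Touch e f) : (M.insert e c).Has f := by
  by_cases hfe : f = e
  · subst hfe
    exact has_insert_self M f c
  · unfold Has
    rw [color_insert_of_ne hfe h]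
    exact hf

theorem color_ne_of_touch {M : Cache n k} {e f : Edge n} (he : M.Has e) (hef : Touch e f)
    (hne : e ≠ f) : M.color e ≠ M.color f := by
  obtain ⟨c, hc⟩ := Option.ne_none_iff_exists'.1 he
  intro h
  exact hne (M.proper c e f hc (h ▸ hc) hef)

theorem one_le_fetchCost_insert {M : Cache n k} {e : Edge n} (he : ¬ M.Has e) (c : Fin k) :
    1 ≤ fetchCost M (M.insert e c) := by
  classical
  unfold fetchCost
  refine Finset.card_pos.2 ⟨e, ?_⟩
  have : M.color e = none := by simpa [Has] using he
  simp [color_insert_self, this]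

end Cache

end Insertion

namespace OnlineAlg

variable {n k : ℕ}

theorem runFrom_append (A : OnlineAlg n k) (x : Execution n k) (σ τ : List (Edge n)) :
    A.runFrom x (σ ++ τ) = (A.runFrom x σ).bind fun y => A.runFrom y τ := by
  induction σ generalizing x with
  | nil => simp [runFrom]
  | cons e σ ih => simp [runFrom, ih, PMF.bind_bind]

theorem mean_runFrom_append (A : OnlineAlg n k) (x : Execution n k) (σ τ : List (Edge n))
    (f : Execution n k → ℝ≥0∞) :
    mean (A.runFrom x (σ ++ τ)) f = mean (A.runFrom x σ) fun y => mean (A.runFrom y τ) f := by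
  rw [runFrom_append, mean_bind]

theorem mean_runFrom_singleton (A : OnlineAlg n k) (x : Execution n k) (e : Edge n)
    (f : Execution n k → ℝ≥0∞) :
    mean (A.runFrom x [e]) f = mean (A x e) fun M => f ((e, M) :: x) := by
  simp [runFrom, mean_bind, mean_pure]

theorem expectedCost_eq_mean (A : OnlineAlg n k) (σ : List (Edge n)) :
    A.expectedCost σ = mean (A.runFrom [] σ) fun x => (x.cost : ℝ≥0∞) := rfl

/-- A function of the cache that never drops by more than the cost of a step, in expectation,
bounds the expected cost of a whole run from below. -/
theorem le_mean_runFrom_of_step (A : OnlineAlg n k) (V : Cache n k → ℝ≥0∞) (σ : List (Edge n))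
    (hV : ∀ (x : Execution n k), ∀ e ∈ σ, V x.current ≤
      mean (A x e) fun M => (Cache.fetchCost x.current M : ℝ≥0∞) + V M)
    (x : Execution n k) :
    (x.cost : ℝ≥0∞) + V x.current ≤
      mean (A.runFrom x σ) fun y => (y.cost : ℝ≥0∞) + V y.current := by
  induction σ generalizing x with
  | nil => simp [runFrom, mean_pure]
  | cons e σ ih =>
    simp only [runFrom, mean_bind]
    calc (x.cost : ℝ≥0∞) + V x.current
        ≤ x.cost + mean (A x e) fun M => (Cache.fetchCost x.current M : ℝ≥0∞) + V M := by
          gcongr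
          exact hV x e (by simp)
      _ = mean (A x e) fun M =>
            (Execution.cost ((e, M) :: x) : ℝ≥0∞) + V (Execution.current ((e, M) :: x)) := by
          rw [← mean_const (A x e) (x.cost : ℝ≥0∞), ← mean_add]
          simp [Execution.cost, Execution.current, add_assoc]
      _ ≤ _ := mean_mono fun M => ih (fun y f hf => hV y f (by simp [hf])) _

end OnlineAlg

/-! ### Repeated requests fill the cache -/

section Filling

variable {n : ℕ}

/-- The links `q 0, …, q (N - 1)` are all cached. -/
def Full {k : ℕ} (q : ℕ → Edge n) (N : ℕ) (M : Cache n k) : Prop := ∀ i < N, M.Has (q i)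

open Classical in
/-- The indicator of the event that one of the links `q 0, …, q (N - 1)` is not cached. -/
noncomputable def miss {k : ℕ} (q : ℕ → Edge n) (N : ℕ) (M : Cache n k) : ℝ≥0∞ :=
  if Full q N M then 0 else 1

/-- The request sequence `q 0, …, q (N - 1)`. -/
def pass (q : ℕ → Edge n) (N : ℕ) : List (Edge n) := (List.range N).map q

/-- The request sequence `σ`, repeated `T` times. -/
def rounds (σ : List (Edge n)) (T : ℕ) : List (Edge n) := (List.replicate T σ).flatten

/-- Every link touches at most one of its predecessors. -/
def Branchless (q : ℕ → Edge n) (N : ℕ) : Prop :=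
  ∀ i < N, ∀ j < i, ∀ l < i, Touch (q i) (q j) → Touch (q i) (q l) → j = l

theorem mem_pass {q : ℕ → Edge n} {N : ℕ} {e : Edge n} :
    e ∈ pass q N ↔ ∃ i < N, q i = e := by
  simp [pass]

theorem pass_succ (q : ℕ → Edge n) (N : ℕ) : pass q (N + 1) = pass q N ++ [q N] := by
  simp [pass, List.range_succ]

theorem mem_of_mem_rounds {σ : List (Edge n)} {T : ℕ} {e : Edge n} (h : e ∈ rounds σ T) :
    e ∈ σ := by
  simp only [rounds, List.mem_flatten, List.mem_replicate] at h
  obtain ⟨l, ⟨-, rfl⟩, h⟩ := h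
  exact h

theorem rounds_succ (σ : List (Edge n)) (T : ℕ) : rounds σ (T + 1) = σ ++ rounds σ T := by
  simp [rounds, List.replicate_succ]

theorem miss_le_one {k : ℕ} (q : ℕ → Edge n) (N : ℕ) (M : Cache n k) : miss q N M ≤ 1 := by
  unfold miss
  split_ifs <;> simp

theorem miss_eq_zero {k : ℕ} {q : ℕ → Edge n} {N : ℕ} {M : Cache n k} (h : Full q N M) :
    miss q N M = 0 := by
  simp [miss, h]

theorem miss_eq_one {k : ℕ} {q : ℕ → Edge n} {N : ℕ} {M : Cache n k} (h : ¬ Full q N M) :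
    miss q N M = 1 := by
  simp [miss, h]

theorem Full.insert {k : ℕ} {q : ℕ → Edge n} {N : ℕ} {M : Cache n k} {c : Fin k}
    (hM : Full q N M) (hc : ∀ i < N, M.color (q i) = some c → ¬ Touch (q N) (q i)) :
    Full q (N + 1) (M.insert (q N) c) := by
  intro i hi
  rcases Nat.lt_succ_iff_lt_or_eq.1 hi with hi | rfl
  · exact (hM i hi).insert (hc i hi)
  · exact Cache.has_insert_self _ _ _

variable {A : OnlineAlg n 2}

/-- If the predecessors of a link are cached, then with probability at least `1/2` they still
are, together with the link, after it has been requested: at most one of them is in the way, and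
only in one of the two matchings. -/
theorem mean_miss_succ_le (hA : A.IsNaive) {q : ℕ → Edge n} {N : ℕ} (hq : Branchless q (N + 1))
    {x : Execution n 2} (hx : Full q N x.current) :
    mean (A x (q N)) (miss q (N + 1)) ≤ 1 / 2 := by
  by_cases hhit : x.current.Has (q N)
  · rw [hA.hit x _ hhit, mean_pure, miss_eq_zero]
    · simp
    · intro i hi
      rcases Nat.lt_succ_iff_lt_or_eq.1 hi with hi | rfl
      · exact hx i hi
      · exact hhit
  by_cases hfit : ∃ c, x.current.Free (q N) c
  · have h0 : mean (A x (q N)) (miss q (N + 1)) ≤ mean (A x (q N)) fun _ => 0 := by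
      refine mean_mono_of_support fun M hM => ?_
      obtain ⟨c, hc, rfl⟩ := hA.fits x _ hhit hfit M hM
      rw [miss_eq_zero (hx.insert fun i _ hi ht => hc _ hi ht)]
    rw [mean_const] at h0
    exact h0.trans (by simp)
  · obtain ⟨a, ha⟩ : ∃ a : Fin 2, ∀ i < N, x.current.color (q i) = some a →
        ¬ Touch (q N) (q i) := by
      by_cases hj : ∃ j < N, Touch (q N) (q j)
      · obtain ⟨j, hj, hjt⟩ := hj
        obtain ⟨b, hb⟩ := Option.ne_none_iff_exists'.1 (hx j hj)
        -- In `Fin 2`, `b + 1` is the matching other than `b`.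
        refine ⟨b + 1, fun i hi hic hit => ?_⟩
        have hij : i = j := hq N (by omega) i hi j hj hit hjt
        subst hij
        rw [hb] at hic
        revert hic
        fin_cases b <;> simp
      · push Not at hj
        exact ⟨0, fun i hi _ => hj i hi⟩
    have hne : a ≠ a + 1 := by fin_cases a <;> simp
    rw [hA.conflict x _ hhit hfit, mean_map, mean_uniform_two hne, miss_eq_zero (hx.insert ha),
      zero_add]
    gcongr
    exact miss_le_one _ _ _

theorem exists_mean_miss_pass_le (hA : A.IsNaive) (q : ℕ → Edge n) (N : ℕ)
    (hq : Branchless q N) :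
    ∃ r : ℝ≥0∞, r < 1 ∧ ∀ x : Execution n 2,
      mean (A.runFrom x (pass q N)) (fun y => miss q N y.current) ≤ r := by
  induction N with
  | zero =>
    refine ⟨0, by simp, fun x => ?_⟩
    have : ∀ M : Cache n 2, miss q 0 M = 0 := fun M => miss_eq_zero (by simp [Full])
    simp [this, mean_const]
  | succ N ih =>
    obtain ⟨r, hr, h⟩ := ih fun i hi => hq i (by omega)
    refine ⟨1 / 2 + 1 / 2 * r, ?_, fun x => ?_⟩
    · have h2 : (1 / 2 : ℝ≥0∞) * r < 1 / 2 := by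
        calc (1 / 2 : ℝ≥0∞) * r < 1 / 2 * 1 :=
              ENNReal.mul_lt_mul_right (by simp) (by simp) hr
          _ = 1 / 2 := mul_one _
      calc (1 / 2 : ℝ≥0∞) + 1 / 2 * r < 1 / 2 + 1 / 2 :=
            ENNReal.add_lt_add_left (by simp) h2
        _ = 1 := ENNReal.add_halves 1
    · rw [pass_succ, OnlineAlg.mean_runFrom_append]
      calc mean (A.runFrom x (pass q N)) (fun y => mean (A.runFrom y [q N])
              fun z => miss q (N + 1) z.current)
          ≤ mean (A.runFrom x (pass q N)) (fun y => 1 / 2 + 1 / 2 * miss q N y.current) := by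
            refine mean_mono fun y => ?_
            rw [OnlineAlg.mean_runFrom_singleton]
            by_cases hy : Full q N y.current
            · exact (mean_miss_succ_le hA hq hy).trans (by simp)
            · rw [miss_eq_one hy, mul_one, ENNReal.add_halves]
              exact (mean_mono fun M => miss_le_one q (N + 1) M).trans (mean_const _ _).le
        _ = 1 / 2 + 1 / 2 * mean (A.runFrom x (pass q N)) (fun y => miss q N y.current) := by
            rw [mean_add, mean_const, mean_const_mul]
        _ ≤ _ := by gcongr; exact h x

/-- Requests for cached links change nothing. -/
theorem mean_miss_of_full (hA : A.IsNaive) {q : ℕ → Edge n} {N : ℕ} (σ : List (Edge n))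
    (hσ : ∀ e ∈ σ, e ∈ pass q N) {x : Execution n 2} (hx : Full q N x.current) :
    mean (A.runFrom x σ) (fun y => miss q N y.current) = 0 := by
  induction σ generalizing x with
  | nil => simp [OnlineAlg.runFrom, mean_pure, miss_eq_zero hx]
  | cons e σ ih =>
    obtain ⟨i, hi, rfl⟩ := mem_pass.1 (hσ e (by simp))
    simp only [OnlineAlg.runFrom, mean_bind, hA.hit x _ (hx i hi), mean_pure]
    exact ih (fun f hf => hσ f (by simp [hf])) hx

theorem exists_mean_miss_rounds_le (hA : A.IsNaive) {q : ℕ → Edge n} {N : ℕ}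
    (hq : Branchless q N) {ε : ℝ≥0∞} (hε : 0 < ε) :
    ∃ T : ℕ, ∀ x : Execution n 2,
      mean (A.runFrom x (rounds (pass q N) T)) (fun y => miss q N y.current) ≤ ε := by
  obtain ⟨r, hr, h⟩ := exists_mean_miss_pass_le hA q N hq
  have hpow : ∀ (T : ℕ) (x : Execution n 2),
      mean (A.runFrom x (rounds (pass q N) T)) (fun y => miss q N y.current) ≤ r ^ T := by
    intro T
    induction T with
    | zero =>
      intro x
      exact (mean_mono fun y => miss_le_one q N _).trans (by simp [mean_const])
    | succ T ih =>
      intro x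
      rw [rounds_succ, OnlineAlg.mean_runFrom_append, pow_succ]
      calc mean (A.runFrom x (pass q N)) (fun y => mean (A.runFrom y (rounds (pass q N) T))
              fun z => miss q N z.current)
          ≤ mean (A.runFrom x (pass q N)) (fun y => r ^ T * miss q N y.current) := by
            refine mean_mono fun y => ?_
            by_cases hy : Full q N y.current
            · rw [mean_miss_of_full hA _ (fun e he => mem_of_mem_rounds he) hy]
              simp
            · rw [miss_eq_one hy, mul_one]
              exact ih y
        _ ≤ _ := by
            rw [mean_const_mul]
            gcongr
            exact h x
  have hlim := ENNReal.tendsto_pow_atTop_nhds_zero_of_lt_one hr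
  obtain ⟨T, hT⟩ := (hlim.eventually (gt_mem_nhds hε)).exists
  exact ⟨T, fun x => (hpow T x).trans hT.le⟩

end Filling

/-! ### The random walk of the missing link -/

section Walk

variable {n : ℕ}

/-- The links `p 0, …, p (m - 1)` are, in this order, the distinct links of a path. -/
structure IsPath (p : ℕ → Edge n) (m : ℕ) : Prop where
  touch_iff : ∀ i < m, ∀ j < m, (Touch (p i) (p j) ↔ i ≤ j + 1 ∧ j ≤ i + 1)
  inj : ∀ i < m, ∀ j < m, p i = p j → i = j

theorem IsPath.branchless {p : ℕ → Edge n} {m : ℕ} (hp : IsPath p m) : Branchless p m := by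
  intro i hi j hj l hl h1 h2
  rw [hp.touch_iff i hi j (by omega)] at h1
  rw [hp.touch_iff i hi l (by omega)] at h2
  omega

theorem IsPath.color_ne {p : ℕ → Edge n} {m : ℕ} (hp : IsPath p m) {M : Cache n 2} {i : ℕ}
    (hi : i + 1 < m) (h : M.Has (p i)) : M.color (p i) ≠ M.color (p (i + 1)) := by
  refine Cache.color_ne_of_touch h ((hp.touch_iff _ (by omega) _ hi).2 (by omega)) fun he => ?_
  have := hp.inj _ (by omega) _ hi he
  omega

/-- Among the links `p 0, …, p L` of a path, all but the inner link `p i` are cached, and the two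
neighbours of `p i` lie in different matchings. Then `p i` cannot be cached, and neither matching
can accommodate it. -/
structure Defect (p : ℕ → Edge n) (L i : ℕ) (M : Cache n 2) : Prop where
  pos : 0 < i
  lt : i < L
  has : ∀ j ≤ L, j ≠ i → M.Has (p j)
  ne : M.color (p (i - 1)) ≠ M.color (p (i + 1))

/-- The expected number of steps that a simple random walk on `0, …, L` takes from the place of
the defect to one of the ends; zero if there is no defect. -/
noncomputable def potential (p : ℕ → Edge n) (L : ℕ) (M : Cache n 2) : ℝ≥0∞ :=
  ⨆ i, ⨆ _ : Defect p L i M, ((i * (L - i) : ℕ) : ℝ≥0∞)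

theorem Defect.le_potential {p : ℕ → Edge n} {L i : ℕ} {M : Cache n 2} (h : Defect p L i M) :
    ((i * (L - i) : ℕ) : ℝ≥0∞) ≤ potential p L M :=
  le_iSup₂ (f := fun i (_ : Defect p L i M) => ((i * (L - i) : ℕ) : ℝ≥0∞)) i h

variable {p : ℕ → Edge n} {L i : ℕ} {M : Cache n 2}

theorem Defect.exists_colors (h : Defect p L i M) :
    ∃ a b : Fin 2, a ≠ b ∧ M.color (p (i - 1)) = some a ∧ M.color (p (i + 1)) = some b := by
  have := h.pos
  have := h.lt
  obtain ⟨a, ha⟩ := Option.ne_none_iff_exists'.1 (h.has (i - 1) (by omega) (by omega))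
  obtain ⟨b, hb⟩ := Option.ne_none_iff_exists'.1 (h.has (i + 1) (by omega) (by omega))
  refine ⟨a, b, ?_, ha, hb⟩
  rintro rfl
  exact h.ne (ha.trans hb.symm)

theorem Defect.not_free (hp : IsPath p (L + 1)) (h : Defect p L i M) :
    ¬ ∃ c, M.Free (p i) c := by
  have := h.pos
  have := h.lt
  obtain ⟨a, b, hab, ha, hb⟩ := h.exists_colors
  rintro ⟨c, hc⟩
  have hac : c ≠ a := by
    rintro rfl
    exact hc _ ha ((hp.touch_iff _ (by omega) _ (by omega)).2 (by omega))
  have hbc : c ≠ b := by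
    rintro rfl
    exact hc _ hb ((hp.touch_iff _ (by omega) _ (by omega)).2 (by omega))
  omega

theorem Defect.not_has (hp : IsPath p (L + 1)) (h : Defect p L i M) : ¬ M.Has (p i) := by
  have := h.pos
  have := h.lt
  intro hi
  obtain ⟨a, b, hab, ha, hb⟩ := h.exists_colors
  obtain ⟨c, hc⟩ := Option.ne_none_iff_exists'.1 hi
  have h1 := hp.color_ne (i := i - 1) (by omega) (h.has _ (by omega) (by omega))
  have h2 := hp.color_ne (i := i) (by omega) hi
  rw [Nat.sub_add_cancel h.pos, ha, hc] at h1
  rw [hb, hc] at h2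
  have h1' : a ≠ c := fun h => h1 (by rw [h])
  have h2' : c ≠ b := fun h => h2 (by rw [h])
  omega

theorem Defect.insert_left (hp : IsPath p (L + 1)) (h : Defect p L i M) {a : Fin 2}
    (ha : M.color (p (i - 1)) = some a) (hi : 0 < i - 1) :
    Defect p L (i - 1) (M.insert (p i) a) := by
  have := h.lt
  refine ⟨hi, by omega, fun j hj hji => ?_, ?_⟩
  · by_cases hj' : j = i
    · subst hj'
      exact Cache.has_insert_self _ _ _
    · refine (h.has j hj hj').insert fun hc ht => ?_
      rw [hp.touch_iff _ (by omega) _ (by omega)] at ht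
      obtain rfl : j = i + 1 := by omega
      exact h.ne (ha.trans hc.symm)
  · have h1 := hp.color_ne (M := M) (i := i - 1 - 1) (by omega) (h.has _ (by omega) (by omega))
    rw [Nat.sub_add_cancel hi, ha] at h1
    rw [Nat.sub_add_cancel h.pos, Cache.color_insert_self, Cache.color_insert_of_ne]
    · exact h1
    · intro he
      have := hp.inj _ (by omega) _ (by omega) he
      omega
    · intro hc
      exact absurd hc h1

theorem Defect.insert_right (hp : IsPath p (L + 1)) (h : Defect p L i M) {b : Fin 2}
    (hb : M.color (p (i + 1)) = some b) (hi : i + 1 < L) :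
    Defect p L (i + 1) (M.insert (p i) b) := by
  have := h.pos
  refine ⟨by omega, hi, fun j hj hji => ?_, ?_⟩
  · by_cases hj' : j = i
    · subst hj'
      exact Cache.has_insert_self _ _ _
    · refine (h.has j hj hj').insert fun hc ht => ?_
      rw [hp.touch_iff _ (by omega) _ (by omega)] at ht
      obtain rfl : j = i - 1 := by omega
      exact h.ne (hc.trans hb.symm)
  · have h1 := hp.color_ne (M := M) (i := i + 1) (by omega) (h.has _ (by omega) (by omega))
    rw [hb] at h1
    rw [Nat.add_sub_cancel, Cache.color_insert_self, Cache.color_insert_of_ne]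
    · exact h1
    · intro he
      have := hp.inj _ (by omega) _ (by omega) he
      omega
    · intro hc
      exact absurd hc.symm h1

theorem potential_le (hp : IsPath p (2 * L + 1)) :
    potential p (2 * L) M ≤ ((L ^ 2 : ℕ) : ℝ≥0∞) * miss p (2 * L + 1) M := by
  refine iSup₂_le fun i h => ?_
  have hlt := h.lt
  rw [miss_eq_one fun hf => h.not_has hp (hf i (by omega)), mul_one]
  have : i * (2 * L - i) ≤ L ^ 2 := by
    obtain ⟨s, hs⟩ : ∃ s, 2 * L = i + s := ⟨2 * L - i, by omega⟩
    rw [hs, Nat.add_sub_cancel_left]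
    zify at hs ⊢
    nlinarith [sq_nonneg ((i : ℤ) - s)]
  exact_mod_cast this

/-- Requesting the missing link of a defect costs one and moves the defect by one step, to either
side with probability `1/2`; all other requests of the path are hits. -/
theorem potential_le_mean {A : OnlineAlg n 2} (hA : A.IsNaive) (hp : IsPath p (L + 1))
    (x : Execution n 2) {e : Edge n} (he : e ∈ pass p (L + 1)) :
    potential p L x.current ≤
      mean (A x e) fun M => (Cache.fetchCost x.current M : ℝ≥0∞) + potential p L M := by
  obtain ⟨j, hj, rfl⟩ := mem_pass.1 he
  refine iSup₂_le fun i h => ?_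
  by_cases hji : j = i
  swap
  · rw [hA.hit x _ (h.has j (by omega) hji), mean_pure]
    exact h.le_potential.trans le_add_self
  subst hji
  obtain ⟨a, b, hab, ha, hb⟩ := h.exists_colors
  have hcost : ∀ c, (1 : ℝ≥0∞) ≤ Cache.fetchCost x.current (x.current.insert (p j) c) :=
    fun c => by exact_mod_cast Cache.one_le_fetchCost_insert (h.not_has hp) c
  have hl : (((j - 1) * (L - (j - 1)) : ℕ) : ℝ≥0∞) ≤
      potential p L (x.current.insert (p j) a) := by
    rcases Nat.eq_zero_or_pos (j - 1) with h0 | h0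
    · simp [h0]
    · exact (h.insert_left hp ha h0).le_potential
  have hr : (((j + 1) * (L - (j + 1)) : ℕ) : ℝ≥0∞) ≤
      potential p L (x.current.insert (p j) b) := by
    rcases Nat.eq_zero_or_pos (L - (j + 1)) with h0 | h0
    · simp [h0]
    · exact (h.insert_right hp hb (by omega)).le_potential
  rw [hA.conflict x _ (h.not_has hp) (h.not_free hp), mean_map, mean_uniform_two hab]
  have hnat : j * (L - j) * 2 ≤
      (1 + (j - 1) * (L - (j - 1))) + (1 + (j + 1) * (L - (j + 1))) := by
    obtain ⟨s, rfl⟩ := Nat.exists_eq_add_of_lt h.pos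
    obtain ⟨t, rfl⟩ := Nat.exists_eq_add_of_lt h.lt
    have e1 : 0 + s + 1 + t + 1 - (0 + s + 1) = t + 1 := by omega
    have e2 : 0 + s + 1 + t + 1 - (0 + s + 1 - 1) = t + 2 := by omega
    have e3 : 0 + s + 1 + t + 1 - (0 + s + 1 + 1) = t := by omega
    have e4 : 0 + s + 1 - 1 = s := by omega
    rw [e1, e2, e3, e4]
    nlinarith
  rw [ENNReal.le_div_iff_mul_le (by simp) (by simp)]
  calc ((j * (L - j) : ℕ) : ℝ≥0∞) * 2
      ≤ (1 + ((j - 1) * (L - (j - 1)) : ℕ)) + (1 + ((j + 1) * (L - (j + 1)) : ℕ)) := by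
        exact_mod_cast hnat
    _ ≤ _ := add_le_add (add_le_add (hcost a) hl) (add_le_add (hcost b) hr)

end Walk

/-! ### The offline cost -/

section Offline

variable {n : ℕ}

open Classical in
/-- The cache that holds exactly the links of a path, in alternating matchings. -/
noncomputable def IsPath.cache {p : ℕ → Edge n} {m : ℕ} (hp : IsPath p m) : Cache n 2 where
  color := fun e => if h : ∃ i < m, p i = e then some (Fin.ofNat 2 h.choose) else none
  proper := by
    intro c e f he hf hef
    split_ifs at he with h1
    split_ifs at hf with h2
    obtain ⟨hi, hie⟩ := h1.choose_spec
    obtain ⟨hj, hjf⟩ := h2.choose_spec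
    have ht : Touch (p h1.choose) (p h2.choose) := by rwa [hie, hjf]
    rw [hp.touch_iff _ hi _ hj] at ht
    have hmod : h1.choose % 2 = h2.choose % 2 := by
      have := Option.some.inj (he.trans hf.symm)
      simpa [Fin.ext_iff] using this
    have : h1.choose = h2.choose := by omega
    rw [← hie, ← hjf, this]

theorem IsPath.has_cache {p : ℕ → Edge n} {m : ℕ} (hp : IsPath p m) {e : Edge n} :
    hp.cache.Has e ↔ e ∈ pass p m := by
  rw [mem_pass]
  simp [Cache.Has, IsPath.cache]

theorem IsPath.fetchCost_cache_le {p : ℕ → Edge n} {m : ℕ} (hp : IsPath p m) (M : Cache n 2) :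
    Cache.fetchCost M hp.cache ≤ m := by
  classical
  calc Cache.fetchCost M hp.cache ≤ ((Finset.range m).image p).card := by
        refine Finset.card_le_card fun e he => ?_
        obtain ⟨i, hi, hie⟩ := mem_pass.1 (hp.has_cache.1 (Finset.mem_filter.1 he).2.1)
        exact Finset.mem_image.2 ⟨i, Finset.mem_range.2 hi, hie⟩
    _ ≤ m := Finset.card_image_le.trans (Finset.card_range m).le

theorem Cache.fetchCost_self {k : ℕ} (M : Cache n k) : fetchCost M M = 0 := by
  simp [fetchCost]

theorem Execution.Serves.snoc {k : ℕ} {x : Execution n k} {σ : List (Edge n)} (hx : x.Serves σ)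
    {e : Edge n} {M : Cache n k} (he : M.Has e) : Serves ((e, M) :: x) (σ ++ [e]) := by
  refine ⟨by simp [← hx.1], fun p hp => ?_⟩
  rcases List.mem_cons.1 hp with rfl | hp
  · exact he
  · exact hx.2 p hp

/-- A cache that contains all links of `τ` serves `τ` at the price of moving to that cache. -/
theorem Execution.Serves.exists_append {k : ℕ} {x : Execution n k} {σ : List (Edge n)}
    (hx : x.Serves σ) (M : Cache n k) {m : ℕ} (hm : ∀ M', Cache.fetchCost M' M ≤ m)
    (τ : List (Edge n)) (hτ : ∀ e ∈ τ, M.Has e) :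
    ∃ y : Execution n k, y.Serves (σ ++ τ) ∧ y.cost ≤ x.cost + m := by
  suffices h : ∃ y : Execution n k, y.Serves (σ ++ τ) ∧ y.cost ≤ x.cost + m ∧
      (y.cost = x.cost ∨ y.current = M) by
    obtain ⟨y, h1, h2, -⟩ := h
    exact ⟨y, h1, h2⟩
  induction τ using List.reverseRecOn with
  | nil => exact ⟨x, by simpa using hx, by omega, Or.inl rfl⟩
  | append_singleton τ e ih =>
    obtain ⟨y, hy, hc, hor⟩ := ih fun f hf => hτ f (by simp [hf])
    refine ⟨(e, M) :: y, ?_, ?_, Or.inr rfl⟩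
    · rw [← List.append_assoc]
      exact hy.snoc (hτ e (by simp))
    · have := hm y.current
      rcases hor with h | h
      · simp only [Execution.cost]
        omega
      · simp only [Execution.cost, h, Cache.fetchCost_self]
        omega

end Offline

/-! ### Two paths through the same links -/

section Zigzag

variable {n : ℕ}

/-- The path that visits alternately the vertices `u 0, u 1, …` on one side and `w 0, w 1, …` on
the other, starting with the link `(u 0, w 0)`. -/
def zigzag (u w : ℕ → Fin n) (j : ℕ) : Edge n := (u (j / 2), w ((j + 1) / 2))

theorem isPath_zigzag {u w : ℕ → Fin n} {b : ℕ} (hu : Set.InjOn u (Set.Iic b))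
    (hw : Set.InjOn w (Set.Iic b)) : IsPath (zigzag u w) (2 * b + 1) := by
  have key : ∀ i < 2 * b + 1, ∀ j < 2 * b + 1,
      (u (i / 2) = u (j / 2) ↔ i / 2 = j / 2) ∧
        (w ((i + 1) / 2) = w ((j + 1) / 2) ↔ (i + 1) / 2 = (j + 1) / 2) := fun i hi j hj =>
    ⟨hu.eq_iff (Set.mem_Iic.2 (by omega)) (Set.mem_Iic.2 (by omega)),
      hw.eq_iff (Set.mem_Iic.2 (by omega)) (Set.mem_Iic.2 (by omega))⟩
  refine ⟨fun i hi j hj => ?_, fun i hi j hj h => ?_⟩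
  · simp only [Touch, zigzag, key i hi j hj]
    omega
  · simp only [zigzag, Prod.mk.injEq, key i hi j hj] at h
    omega

/-- The vertex with number `j`; the numbers are meant to be smaller than `n`. -/
def node (n : ℕ) [NeZero n] (j : ℕ) : Fin n := Fin.ofNat n j

theorem node_inj [NeZero n] {i j : ℕ} (hi : i < n) (hj : j < n) (h : node n i = node n j) :
    i = j := by
  simpa [node, Fin.ext_iff, Nat.mod_eq_of_lt hi, Nat.mod_eq_of_lt hj] using h

/-- The path through the vertices in their natural order. -/
def straight (n : ℕ) [NeZero n] : ℕ → Edge n :=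
  zigzag (node n) (node n)

/-- The path that follows the first `2 * b` links of `straight`, jumps to the far end of its link
number `4 * b`, and comes back along the links with numbers from `4 * b` down to `2 * b + 1`. -/
def folded (n b : ℕ) [NeZero n] : ℕ → Edge n :=
  zigzag (fun t => node n (if t < b then t else 3 * b - t))
    (fun t => node n (if t ≤ b then t else 3 * b + 1 - t))

/-- The links of `straight` other than the one with number `2 * b`, which is the middle one of the
first `4 * b + 1`. -/
def halves (n b : ℕ) [NeZero n] (j : ℕ) : Edge n :=
  straight n (if j < 2 * b then j else j + 1)

variable [NeZero n] {b : ℕ}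

theorem isPath_straight (hb : 2 * b < n) : IsPath (straight n) (2 * (2 * b) + 1) := by
  refine isPath_zigzag ?_ ?_ <;>
  · intro i hi j hj h
    rw [Set.mem_Iic] at hi hj
    exact node_inj (by omega) (by omega) h

theorem isPath_folded (hb : 2 * b < n) : IsPath (folded n b) (2 * (2 * b) + 1) := by
  refine isPath_zigzag ?_ ?_ <;>
  · intro i hi j hj h
    rw [Set.mem_Iic] at hi hj
    have := node_inj (by split_ifs <;> omega) (by split_ifs <;> omega) h
    split_ifs at this <;> omega

theorem branchless_halves (hb : 2 * b < n) : Branchless (halves n b) (2 * (2 * b)) := by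
  intro i hi j hj l hl h1 h2
  unfold halves at h1 h2
  rw [(isPath_straight hb).touch_iff _ (by split_ifs <;> omega) _ (by split_ifs <;> omega)]
    at h1 h2
  split_ifs at h1 h2 <;> omega

theorem folded_of_lt {j : ℕ} (hj : j < 2 * b) : folded n b j = straight n j := by
  have h1 : j / 2 < b := by omega
  have h2 : (j + 1) / 2 ≤ b := by omega
  simp [folded, straight, zigzag, h1, h2]

theorem folded_of_gt {j : ℕ} (hj : 2 * b < j) (hj' : j ≤ 4 * b) :
    folded n b j = straight n (6 * b + 1 - j) := by
  have h1 : ¬ j / 2 < b := by omega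
  have h2 : ¬ (j + 1) / 2 ≤ b := by omega
  have h3 : 3 * b - j / 2 = (6 * b + 1 - j) / 2 := by omega
  have h4 : 3 * b + 1 - (j + 1) / 2 = (6 * b + 1 - j + 1) / 2 := by omega
  simp [folded, straight, zigzag, h1, h2, h3, h4]

theorem has_straight {k : ℕ} {M : Cache n k} (hM : Full (halves n b) (2 * (2 * b)) M) {j : ℕ}
    (hj : j ≤ 2 * (2 * b)) (hne : j ≠ 2 * b) : M.Has (straight n j) := by
  rcases lt_or_gt_of_ne hne with h | h
  · simpa [halves, h] using hM j (by omega)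
  · have := hM (j - 1) (by omega)
    have h1 : ¬ j - 1 < 2 * b := by omega
    rwa [halves, if_neg h1, Nat.sub_add_cancel (by omega)] at this

theorem has_folded {k : ℕ} {M : Cache n k} (hM : Full (halves n b) (2 * (2 * b)) M) {j : ℕ}
    (hj : j ≤ 2 * (2 * b)) (hne : j ≠ 2 * b) : M.Has (folded n b j) := by
  rcases lt_or_gt_of_ne hne with h | h
  · rw [folded_of_lt h]
    exact has_straight hM hj hne
  · rw [folded_of_gt h (by omega)]
    exact has_straight hM (by omega) (by omega)

theorem mem_pass_of_mem_halves {e : Edge n} (he : e ∈ pass (halves n b) (2 * (2 * b))) :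
    e ∈ pass (straight n) (2 * (2 * b) + 1) ∧ e ∈ pass (folded n b) (2 * (2 * b) + 1) := by
  obtain ⟨i, hi, rfl⟩ := mem_pass.1 he
  by_cases h : i < 2 * b
  · refine ⟨mem_pass.2 ⟨i, by omega, by simp [halves, h]⟩, mem_pass.2 ⟨i, by omega, ?_⟩⟩
    rw [folded_of_lt h]
    simp [halves, h]
  · refine ⟨mem_pass.2 ⟨i + 1, by omega, by simp [halves, h]⟩,
      mem_pass.2 ⟨6 * b + 1 - (i + 1), by omega, ?_⟩⟩
    rw [folded_of_gt (by omega) (by omega), halves, if_neg h]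
    congr 1
    omega

/-- The colours along the second half alternate, and its number of links is even, so its two ends
lie in different matchings. -/
theorem color_straight_ends (hb : 2 * b < n) (hb0 : 0 < b) {M : Cache n 2}
    (hM : Full (halves n b) (2 * (2 * b)) M) :
    M.color (straight n (2 * b + 1)) ≠ M.color (straight n (4 * b)) := by
  have hp := isPath_straight hb
  have key : ∀ t < b, M.color (straight n (2 * b + 1 + 2 * t)) =
      M.color (straight n (2 * b + 1)) := by
    intro t
    induction t with
    | zero => simp
    | succ t ih =>
      intro ht
      have hs : ∀ s ≤ 2, ∃ c, M.color (straight n (2 * b + 1 + 2 * t + s)) = some c :=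
        fun s hs => Option.ne_none_iff_exists'.1 (has_straight hM (by omega) (by omega))
      obtain ⟨c0, h0⟩ := hs 0 (by omega)
      obtain ⟨c1, h1⟩ := hs 1 (by omega)
      obtain ⟨c2, h2⟩ := hs 2 (by omega)
      have n1 := hp.color_ne (M := M) (i := 2 * b + 1 + 2 * t) (by omega)
        (has_straight hM (by omega) (by omega))
      have n2 := hp.color_ne (M := M) (i := 2 * b + 1 + 2 * t + 1) (by omega)
        (has_straight hM (by omega) (by omega))
      rw [← ih (by omega), show 2 * b + 1 + 2 * (t + 1) = 2 * b + 1 + 2 * t + 2 by ring, h2]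
      rw [add_zero] at h0
      rw [h0, h1] at n1
      rw [h1, h2] at n2
      rw [h0]
      have n1' : c0 ≠ c1 := fun h => n1 (by rw [h])
      have n2' : c1 ≠ c2 := fun h => n2 (by rw [h])
      congr 1
      omega
  have h := hp.color_ne (M := M) (i := 2 * b + 1 + 2 * (b - 1)) (by omega)
    (has_straight hM (by omega) (by omega))
  rw [key (b - 1) (by omega)] at h
  rwa [show 2 * b + 1 + 2 * (b - 1) + 1 = 4 * b by omega] at h

/-- Once both halves are cached, the middle link of one of the two paths meets a conflict. -/
theorem le_potential_add_potential (hb : 2 * b < n) (hb0 : 0 < b) (M : Cache n 2) :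
    (((2 * b) ^ 2 : ℕ) : ℝ≥0∞) ≤
      potential (straight n) (2 * (2 * b)) M + potential (folded n b) (2 * (2 * b)) M +
        (((2 * b) ^ 2 : ℕ) : ℝ≥0∞) * miss (halves n b) (2 * (2 * b)) M := by
  by_cases hM : Full (halves n b) (2 * (2 * b)) M
  swap
  · rw [miss_eq_one hM, mul_one]
    exact le_add_self
  have hval : (2 * b) * (2 * (2 * b) - 2 * b) = (2 * b) ^ 2 := by
    rw [show 2 * (2 * b) - 2 * b = 2 * b by omega, sq]
  rw [← hval, miss_eq_zero hM, mul_zero, add_zero]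
  by_cases hc : M.color (straight n (2 * b - 1)) = M.color (straight n (2 * b + 1))
  · refine le_add_left (Defect.le_potential ⟨by omega, by omega,
      fun j hj hne => has_folded hM hj hne, ?_⟩)
    rw [folded_of_lt (by omega), folded_of_gt (by omega) (by omega), hc,
      show 6 * b + 1 - (2 * b + 1) = 4 * b by omega]
    exact color_straight_ends hb hb0 hM
  · exact le_add_right (Defect.le_potential ⟨by omega, by omega,
      fun j hj hne => has_straight hM hj hne, hc⟩)

end Zigzag

/-! ### The cost of a phase -/

section Phases

variable {n : ℕ} {A : OnlineAlg n 2}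

/-- After a preparation `ρ` the rest of a phase requests the links of a path `p` over and over.
The expected cost of the phase is at least the expected potential after the preparation, up to
the potential that remains at its end. -/
theorem add_le_expectedCost_append (hA : A.IsNaive) {p : ℕ → Edge n} {L : ℕ}
    (hp : IsPath p (2 * L + 1)) (σ ρ τ : List (Edge n)) (hτ : ∀ e ∈ τ, e ∈ pass p (2 * L + 1))
    {ε : ℝ≥0∞}
    (hε : ∀ x, mean (A.runFrom x τ) (fun y => miss p (2 * L + 1) y.current) ≤ ε) :
    A.expectedCost σ + mean (A.runFrom [] (σ ++ ρ)) (fun y => potential p (2 * L) y.current) ≤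
      A.expectedCost (σ ++ ρ ++ τ) + ((L ^ 2 : ℕ) : ℝ≥0∞) * ε := by
  have hmono : A.expectedCost σ ≤ A.expectedCost (σ ++ ρ) := by
    rw [OnlineAlg.expectedCost_eq_mean, OnlineAlg.expectedCost_eq_mean,
      OnlineAlg.mean_runFrom_append]
    refine mean_mono fun x => ?_
    have := A.le_mean_runFrom_of_step (fun _ => 0) ρ (fun _ _ _ => zero_le) x
    simpa using this
  have hrun : A.expectedCost (σ ++ ρ) +
      mean (A.runFrom [] (σ ++ ρ)) (fun y => potential p (2 * L) y.current) ≤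
      A.expectedCost (σ ++ ρ ++ τ) +
        mean (A.runFrom [] (σ ++ ρ ++ τ)) (fun y => potential p (2 * L) y.current) := by
    rw [OnlineAlg.expectedCost_eq_mean, OnlineAlg.expectedCost_eq_mean, ← mean_add, ← mean_add,
      OnlineAlg.mean_runFrom_append _ _ (σ ++ ρ)]
    exact mean_mono fun x => A.le_mean_runFrom_of_step _ τ
      (fun y e he => potential_le_mean hA hp y (hτ e he)) x
  refine (add_le_add_left hmono _).trans (hrun.trans (add_le_add_right ?_ _))
  rw [OnlineAlg.mean_runFrom_append]
  calc _ ≤ mean (A.runFrom [] (σ ++ ρ)) (fun _ => ((L ^ 2 : ℕ) : ℝ≥0∞) * ε) := by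
        refine mean_mono fun x => ?_
        refine (mean_mono fun y => potential_le hp).trans ?_
        rw [mean_const_mul]
        gcongr
        exact hε x
    _ = _ := mean_const _ _

/-- A phase costs the algorithm at least `b ^ 2 / 2` in expectation, while `4 * b + 1` suffices
offline. -/
theorem exists_requests [NeZero n] {b : ℕ} (hb : 2 * b < n) (hb0 : 0 < b) (hA : A.IsNaive)
    (K : ℕ) :
    ∃ σ : List (Edge n), ((K * b ^ 2 : ℕ) : ℝ≥0∞) ≤ 2 * A.expectedCost σ ∧
      ∃ x : Execution n 2, x.Serves σ ∧ x.cost ≤ K * (4 * b + 1) := by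
  induction K with
  | zero => exact ⟨[], by simp, [], by simp [Execution.Serves], by simp [Execution.cost]⟩
  | succ K ih =>
    obtain ⟨σ, hσ, x, hx, hxc⟩ := ih
    have h4 : (0 : ℝ≥0∞) < 1 / 4 := by simp
    obtain ⟨T₀, hT₀⟩ := exists_mean_miss_rounds_le hA (branchless_halves hb) h4
    set ρ := rounds (pass (halves n b) (2 * (2 * b))) T₀ with hρ
    have hB : (((2 * b) ^ 2 : ℕ) : ℝ≥0∞) * (1 / 4) = ((b ^ 2 : ℕ) : ℝ≥0∞) := by
      rw [show (2 * b) ^ 2 = b ^ 2 * 4 by ring, Nat.cast_mul, mul_assoc]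
      simp [ENNReal.mul_inv_cancel]
    -- The two paths together have potential at least `4 * b ^ 2 - b ^ 2` after the preparation.
    have hsum : ((3 * b ^ 2 : ℕ) : ℝ≥0∞) ≤
        mean (A.runFrom [] (σ ++ ρ)) (fun y => potential (straight n) (2 * (2 * b)) y.current) +
        mean (A.runFrom [] (σ ++ ρ)) (fun y => potential (folded n b) (2 * (2 * b)) y.current)
        := by
      have hmiss : mean (A.runFrom [] (σ ++ ρ))
          (fun y => miss (halves n b) (2 * (2 * b)) y.current) ≤ 1 / 4 := by
        rw [OnlineAlg.mean_runFrom_append]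
        exact (mean_mono hT₀).trans (mean_const _ _).le
      have h := mean_mono (p := A.runFrom [] (σ ++ ρ))
        fun y => le_potential_add_potential hb hb0 y.current
      rw [mean_const, mean_add, mean_add, mean_const_mul] at h
      have h' := h.trans (add_le_add_right (mul_le_mul_right hmiss _) _)
      rw [hB, show (2 * b) ^ 2 = 3 * b ^ 2 + b ^ 2 by ring, Nat.cast_add] at h'
      exact (ENNReal.add_le_add_iff_right (ENNReal.natCast_ne_top _)).1 h'
    obtain ⟨p, hp, hsub, hpot⟩ : ∃ p : ℕ → Edge n, IsPath p (2 * (2 * b) + 1) ∧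
        (∀ e ∈ ρ, e ∈ pass p (2 * (2 * b) + 1)) ∧ ((3 * b ^ 2 : ℕ) : ℝ≥0∞) ≤
          2 * mean (A.runFrom [] (σ ++ ρ)) (fun y => potential p (2 * (2 * b)) y.current) := by
      rcases le_total
        (mean (A.runFrom [] (σ ++ ρ)) fun y => potential (straight n) (2 * (2 * b)) y.current)
        (mean (A.runFrom [] (σ ++ ρ)) fun y => potential (folded n b) (2 * (2 * b)) y.current)
        with h | h
      · refine ⟨folded n b, isPath_folded hb,
          fun e he => (mem_pass_of_mem_halves (mem_of_mem_rounds he)).2, hsum.trans ?_⟩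
        rw [two_mul (mean _ _)]
        exact add_le_add_left h _
      · refine ⟨straight n, isPath_straight hb,
          fun e he => (mem_pass_of_mem_halves (mem_of_mem_rounds he)).1, hsum.trans ?_⟩
        rw [two_mul (mean _ _)]
        exact add_le_add_right h _
    obtain ⟨T, hT⟩ := exists_mean_miss_rounds_le hA hp.branchless h4
    set τ := rounds (pass p (2 * (2 * b) + 1)) T with hτ
    have hτp : ∀ e ∈ τ, e ∈ pass p (2 * (2 * b) + 1) := fun e he => mem_of_mem_rounds he
    refine ⟨σ ++ ρ ++ τ, ?_, ?_⟩
    · have h := add_le_expectedCost_append hA hp σ ρ τ hτp hT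
      rw [hB] at h
      have h2 : ((K * b ^ 2 : ℕ) : ℝ≥0∞) + ((3 * b ^ 2 : ℕ) : ℝ≥0∞) ≤
          2 * A.expectedCost (σ ++ ρ ++ τ) + ((2 * b ^ 2 : ℕ) : ℝ≥0∞) := by
        calc _ ≤ 2 * A.expectedCost σ + 2 * mean (A.runFrom [] (σ ++ ρ))
                (fun y => potential p (2 * (2 * b)) y.current) := add_le_add hσ hpot
          _ ≤ 2 * (A.expectedCost (σ ++ ρ ++ τ) + ((b ^ 2 : ℕ) : ℝ≥0∞)) := by
              rw [← mul_add]
              gcongr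
          _ = _ := by
              push_cast
              ring
      rw [← Nat.cast_add, show K * b ^ 2 + 3 * b ^ 2 = (K + 1) * b ^ 2 + 2 * b ^ 2 by ring,
        Nat.cast_add] at h2
      exact (ENNReal.add_le_add_iff_right (ENNReal.natCast_ne_top _)).1 h2
    · obtain ⟨y, hy, hyc⟩ := hx.exists_append hp.cache (m := 4 * b + 1)
        (fun M' => (hp.fetchCost_cache_le M').trans (by omega)) (ρ ++ τ) (fun e he => by
          rw [hp.has_cache]
          rcases List.mem_append.1 he with he | he
          · exact hsub e he
          · exact hτp e he)
      refine ⟨y, by rwa [List.append_assoc], hyc.trans ?_⟩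
      linarith

end Phases

end CachingInMatchings

/-- For two matchings, the competitive ratio of the naive randomized algorithm is `Ω(n)`. -/
theorem mainTheorem9 :
    ∃ c : ℝ≥0, 0 < c ∧ ∃ N : ℕ, ∀ n : ℕ, N ≤ n →
      ∀ A : CachingInMatchings.OnlineAlg n 2, A.IsNaive →
        ∀ C d : ℝ≥0, A.IsCompetitive C d → c * (n : ℝ≥0) ≤ C := by
  -- A phase costs at least `b ^ 2 / 2` online and `4 * b + 1 ≤ 5 * b` offline, so `C ≥ b / 10`,
  -- and `b ≥ n / 4` as soon as `n ≥ 3`.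
  refine ⟨1 / 40, by norm_num, 3, fun n hn A hA C d hC => ?_⟩
  have : NeZero n := ⟨by omega⟩
  obtain ⟨b, hb⟩ : ∃ b, b = (n - 1) / 2 := ⟨_, rfl⟩
  have hb0 : 0 < b := by omega
  have hK : ∀ K : ℕ, (K : ℝ) * b ^ 2 ≤ K * (2 * C * (4 * b + 1)) + 2 * d := by
    intro K
    obtain ⟨σ, hσ, x, hx, hxc⟩ :=
      CachingInMatchings.exists_requests (by omega : 2 * b < n) hb0 hA K
    have hopt : CachingInMatchings.opt n 2 σ ≤ K * (4 * b + 1) :=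
      le_trans (by unfold CachingInMatchings.opt; exact Nat.sInf_le ⟨x, hx, rfl⟩) hxc
    have h : ((K * b ^ 2 : ℕ) : ℝ≥0∞) ≤ 2 * (C * ((K * (4 * b + 1) : ℕ) : ℝ≥0∞) + d) := by
      refine hσ.trans ?_
      gcongr
      refine (hC σ).trans ?_
      gcongr
    have h' : ((K * b ^ 2 : ℕ) : ℝ≥0) ≤ 2 * (C * ((K * (4 * b + 1) : ℕ) : ℝ≥0) + d) := by
      exact_mod_cast h
    have h'' : ((K * b ^ 2 : ℕ) : ℝ) ≤ 2 * (C * ((K * (4 * b + 1) : ℕ) : ℝ) + d) := by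
      exact_mod_cast h'
    push_cast at h''
    linarith
  -- The additive constant `d` is negligible when the number `K` of phases is large.
  have hCb : (b : ℝ) ^ 2 ≤ 2 * C * (4 * b + 1) := by
    by_contra! hlt
    obtain ⟨K, hKlt⟩ := exists_nat_gt (2 * (d : ℝ) / (b ^ 2 - 2 * C * (4 * b + 1)))
    rw [div_lt_iff₀ (by linarith)] at hKlt
    have := hK K
    linarith
  have hb1 : (1 : ℝ) ≤ b := by exact_mod_cast hb0
  have hn4 : (n : ℝ) ≤ 4 * b := by
    have : n ≤ 4 * b := by omega
    exact_mod_cast this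
  have hbC : (b : ℝ) ≤ 10 * C := by
    have hC0 : (0 : ℝ) ≤ C := C.2
    have : (b : ℝ) * b ≤ b * (10 * C) := by nlinarith
    exact le_of_mul_le_mul_left this (by linarith)
  have : (1 / 40 : ℝ) * n ≤ C := by linarith
  exact_mod_cast this
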